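/- Let $\mathbf{k}$ be an algebraically closed field of characteristic $p>2$, and let $A$ be an associative unital $\mathbf{k}$-algebra which is finitely generated as a module over its center $Z$. Assume that $Z$ is a Noetherian normal (that is, integrally closed) domain, that $A/Z$ is a Cohen–Macaulay $Z$-module (for every prime $\mathfrak p$ of $Z$, the localization $(A/Z)_{\mathfrak p}$ is zero or its depth equals the dimension of its support), and that $\mathrm{Ann}_Z(A/Z)=0$. Assume moreover that the complement in $\operatorname{Spec} Z$ of the Azumaya locus $\{\mathfrak p\in\operatorname{Spec} Z : A_{\mathfrak p} \text{ is an Azumaya algebra over } Z_{\mathfrak p}\}$ has codimension $\geq 2$, i.e. every prime of $Z$ outside the Azumaya locus has height at least $2$. Then every $\mathbf{k}$-linear derivation $D:A\to A$ with $D(Z)=0$ is inner, i.e. $D=\mathrm{ad}(x)=[x,-]$ for some $x\in A$. Equivalently, the restriction map $HH^1(A)\to \mathrm{Der}_{\mathbf{k}}(Z,Z)$ is injective, where $HH^1(A)=\mathrm{Der}_{\mathbf{k}}(A,A)/\mathrm{ad}(A)$ is the first Hochschild cohomology of $A$ over $\mathbf{k}$. -/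

import Mathlib

open scoped TensorProduct

noncomputable section

/-- The algebra structure on `A` over its center. -/
instance centerAlgebra (k : Type*) (A : Type*) [CommRing k] [Ring A] [Algebra k A] :
    Algebra (Subalgebra.center k A) A where
  algebraMap := (Subalgebra.center k A).val.toRingHom
  commutes' z a := (Subalgebra.mem_center_iff.mp z.2 a).symm
  smul_def' _ _ := rfl

/-! ### Derivations and the first Hochschild cohomology of an associative algebra -/

namespace AssocAlg

variable (k : Type*) (A : Type*) [CommRing k] [Ring A] [Algebra k A]

/-- The `k`-submodule of `Hom_k(A, A)` of the maps `D` with `D (ab) = a D(b) + D(a) b`. -/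
def derSubmodule : Submodule k (A →ₗ[k] A) where
  carrier := {D | ∀ a b : A, D (a * b) = a * D b + D a * b}
  add_mem' := by
    intro D E hD hE a b
    simp only [LinearMap.add_apply, hD a b, hE a b, mul_add, add_mul]
    abel
  zero_mem' := by
    intro a b
    simp
  smul_mem' := by
    intro c D hD a b
    simp only [LinearMap.smul_apply, hD a b, smul_add, mul_smul_comm, smul_mul_assoc]

/-- `Der_k(A, A)`: the `k`-linear derivations `D : A → A`. -/
def Der : Type _ := derSubmodule k A

instance : AddCommGroup (Der k A) := inferInstanceAs (AddCommGroup (derSubmodule k A))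

instance : Module k (Der k A) := inferInstanceAs (Module k (derSubmodule k A))

variable {k A}

/-- The underlying linear map of a derivation. -/
def Der.toLin (D : Der k A) : A →ₗ[k] A := D.1

instance : FunLike (Der k A) A A where
  coe D := D.toLin
  coe_injective D E h := Subtype.ext (DFunLike.coe_injective h)

theorem Der.leibniz (D : Der k A) (a b : A) : D (a * b) = a * D b + D a * b := D.2 a b

theorem Der.map_add' (D : Der k A) (a b : A) : D (a + b) = D a + D b := map_add D.toLin a b

theorem Der.map_smul' (D : Der k A) (c : k) (a : A) : D (c • a) = c • D a :=
  map_smul D.toLin c a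

theorem Der.add_apply (D E : Der k A) (a : A) : (D + E) a = D a + E a := rfl

theorem Der.smul_apply (c : k) (D : Der k A) (a : A) : (c • D) a = c • D a := rfl

variable (k A)

/-- The adjoint map `x ↦ ad(x) = [x, -]`, from `A` to `Der_k(A, A)`. -/
def ad : A →ₗ[k] Der k A where
  toFun x := ⟨LinearMap.mulLeft k x - LinearMap.mulRight k x, by
    intro a b
    simp only [LinearMap.sub_apply, LinearMap.mulLeft_apply, LinearMap.mulRight_apply, mul_sub,
      sub_mul, mul_assoc]
    abel⟩
  map_add' x y := by
    refine DFunLike.ext _ _ fun a => ?_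
    change (x + y) * a - a * (x + y) = (x * a - a * x) + (y * a - a * y)
    rw [add_mul, mul_add]
    abel
  map_smul' c x := by
    refine DFunLike.ext _ _ fun a => ?_
    change (c • x) * a - a * (c • x) = c • (x * a - a * x)
    rw [smul_mul_assoc, mul_smul_comm, smul_sub]

theorem ad_apply (x a : A) : ad k A x a = x * a - a * x := rfl

/-- The first Hochschild cohomology `HH¹(A)` of `A` over `k`: derivations (the Hochschild
`1`-cocycles) modulo inner derivations (the `1`-coboundaries), so that
`0 → A/Z → Der_k(A, A) → HH¹(A) → 0` is exact, the first map being `ad`. -/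
abbrev HH1 : Type _ := Der k A ⧸ LinearMap.range (ad k A)

/-- A derivation of `A` maps the center of `A` to itself. -/
theorem der_mem_center (D : Der k A) (z : Subalgebra.center k A) :
    D z ∈ Subalgebra.center k A := by
  rw [Subalgebra.mem_center_iff]
  intro b
  have hz : ∀ c : A, c * (z : A) = z * c := Subalgebra.mem_center_iff.mp z.2
  have h1 := D.leibniz b z
  have h2 := D.leibniz z b
  rw [hz b, h2, hz (D b), add_comm] at h1
  exact (add_right_cancel h1).symm

/-- The restriction of derivations of `A` to the center `Z`, as a map
`Der_k(A, A) → Der_k(Z, Z)`. -/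
def resDer : Der k A →ₗ[k] Derivation k (Subalgebra.center k A) (Subalgebra.center k A) where
  toFun D := Derivation.mk'
    { toFun := fun z => ⟨D z, der_mem_center k A D z⟩
      map_add' := fun x y => Subtype.ext (D.map_add' x y)
      map_smul' := fun c x => Subtype.ext (D.map_smul' c x) }
    (fun x y => Subtype.ext (by
      have hy := Subalgebra.mem_center_iff.mp y.2 (D x)
      exact (D.leibniz x y).trans (congrArg (fun t => (x : A) * D y + t) hy)))
  map_add' D E := by
    ext z
    rfl
  map_smul' c D := by
    ext z
    rfl

theorem resDer_apply (D : Der k A) (z : Subalgebra.center k A) :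
    ((resDer k A D z : Subalgebra.center k A) : A) = D z := rfl

/-- The natural restriction map `HH¹(A) → Der_k(Z, Z)`. -/
def resHH1 : HH1 k A →ₗ[k] Derivation k (Subalgebra.center k A) (Subalgebra.center k A) :=
  (LinearMap.range (ad k A)).liftQ (resDer k A) (by
    rintro _ ⟨x, rfl⟩
    rw [LinearMap.mem_ker]
    ext z
    rw [resDer_apply, ad_apply, Subalgebra.mem_center_iff.mp z.2 x, sub_self]
    rfl)

theorem resHH1_mk (D : Der k A) :
    resHH1 k A (Submodule.Quotient.mk D) = resDer k A D := rfl

end AssocAlg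

/-! ### Cohen-Macaulay modules -/

namespace CMModule

/-- The depth of a module `M` over a local ring `R`: the supremum of the lengths of the
`M`-regular sequences contained in the maximal ideal. -/
def localDepth (R : Type*) [CommRing R] [IsLocalRing R] (M : Type*) [AddCommGroup M]
    [Module R M] : ℕ∞ :=
  ⨆ rs : {rs : List R // RingTheory.Sequence.IsRegular M rs ∧
      ∀ r ∈ rs, r ∈ IsLocalRing.maximalIdeal R}, (rs.1.length : ℕ∞)

/-- A module over a (Noetherian) local ring is Cohen-Macaulay if it is zero or its depth equals
the dimension of its support. -/
def IsLocalCM (R : Type*) [CommRing R] [IsLocalRing R] (M : Type*) [AddCommGroup M]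
    [Module R M] : Prop :=
  Subsingleton M ∨ Module.supportDim R M = (localDepth R M : WithBot ℕ∞)

/-- A finitely generated module over a Noetherian ring is Cohen-Macaulay if all its localizations
at prime ideals are. -/
def IsCM (R : Type*) [CommRing R] (M : Type*) [AddCommGroup M] [Module R M] : Prop :=
  ∀ p : PrimeSpectrum R, IsLocalCM (Localization.AtPrime p.asIdeal)
    (LocalizedModule p.asIdeal.primeCompl M)

end CMModule

/-! ### The Azumaya locus and codimension -/

/-- The Azumaya locus of an `R`-algebra `A`: the primes `p` of `R` such that `A_p` is an Azumaya
algebra over `R_p`. -/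
def azumayaLocus (R : Type*) [CommRing R] (A : Type*) [Ring A] [Algebra R A] :
    Set (PrimeSpectrum R) :=
  {p | IsAzumaya (Localization.AtPrime p.asIdeal) (Localization.AtPrime p.asIdeal ⊗[R] A)}

/-- The codimension in `Spec R` of a (closed) subset `Y`: the infimum of the heights of the primes
in `Y`, which is `⊤` for empty `Y`. -/
def specCodim {R : Type*} [CommRing R] (Y : Set (PrimeSpectrum R)) : ℕ∞ :=
  ⨅ p ∈ Y, p.asIdeal.height

end

/-!
A derivation `D` of `A` killing the center `Z` is `Z`-linear, and `A / Z` embeds into the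
`Z`-linear endomorphisms of `A` through `x ↦ [x, -]`. If `D` is not inner, some multiple `E = z D`
has for its obstruction ideal `{r | r E is inner}` a prime `P`, an associated prime of the module
of endomorphisms modulo commutators.

If `A` is Azumaya at `P`, a separability idempotent shows that derivations of the localization are
inner (`IsAzumaya.exists_eq_commutator`), and clearing denominators gives some `s ∉ P` with `s E`
inner, a contradiction.

Otherwise `P` has height at least `2`. As `A / Z` is Cohen-Macaulay with zero annihilator, its
dimension at `P` is the height of `P`, so it has a regular sequence `a, b` in `P`, up to units of
the localization. Write `a E = [x, -]` and `b E = [y, -]`. Then `b x - a y` is central, so that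
`b x = a y` in `A / Z`, and regularity of `b` modulo `a` makes `x` divisible by `a`, up to some
`s ∉ P` (`CMModule.IsCM.exists_regular_pair`): `s x = a w` in `A / Z`. Hence `a (s E) = a [w, -]`,
and `a` cancels because `A` is torsion-free over `Z` (`CMModule.IsCM.eq_zero_of_smul_eq_zero`), so
`s E` is inner, again a contradiction.
-/

noncomputable section

/-! ### Derivations of Azumaya algebras over local rings -/

/-- The evaluation `a ⊗ b ↦ a * f b` on `A ⊗ Aᵐᵒᵖ` of a linear map `f : A → A`. -/
def tensorOpEval {R A : Type*} [CommRing R] [Ring A] [Algebra R A] (f : A →ₗ[R] A) :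
    A ⊗[R] Aᵐᵒᵖ →ₗ[R] A :=
  TensorProduct.lift
    ((LinearMap.mul R A).compl₂ (f ∘ₗ (MulOpposite.opLinearEquiv R).symm.toLinearMap))

theorem tensorOpEval_tmul {R A : Type*} [CommRing R] [Ring A] [Algebra R A] (f : A →ₗ[R] A)
    (a : A) (b : Aᵐᵒᵖ) : tensorOpEval f (a ⊗ₜ b) = a * f b.unop := rfl

/-- Over a local ring, a finite projective nonzero algebra has a linear functional taking the
value `1` at `1`: otherwise the unit would lie in `𝔪 A`, against Nakayama's lemma. -/
theorem exists_dual_one_eq_one (R A : Type*) [CommRing R] [IsLocalRing R] [Ring A] [Algebra R A]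
    [Module.Projective R A] [Module.Finite R A] [Nontrivial A] :
    ∃ f : A →ₗ[R] R, f 1 = 1 := by
  have key : ∃ f : A →ₗ[R] R, IsUnit (f 1) := by
    by_contra! hf
    obtain ⟨s, hs⟩ := Module.Projective.out (R := R) (P := A)
    have h1 : (1 : A) ∈ IsLocalRing.maximalIdeal R • (⊤ : Submodule R A) := by
      rw [← hs 1, Finsupp.linearCombination_apply]
      refine Submodule.sum_mem _ fun i _ => Submodule.smul_mem_smul ?_ trivial
      exact (IsLocalRing.mem_maximalIdeal _).mpr (hf (Finsupp.lapply i ∘ₗ s))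
    have h2 : (⊤ : Submodule R A) ≤ IsLocalRing.maximalIdeal R • (⊤ : Submodule R A) := by
      intro a _
      have := Submodule.mem_map_of_mem (f := LinearMap.mulRight R a) h1
      rw [Submodule.map_smul''] at this
      simpa using Submodule.smul_mono le_rfl le_top this
    have h3 := Submodule.eq_bot_of_le_smul_of_le_jacobson_bot _ _ Module.Finite.fg_top h2
      (IsLocalRing.maximalIdeal_le_jacobson _)
    exact one_ne_zero ((Submodule.mem_bot R).mp (h3 ▸ Submodule.mem_top (x := (1 : A))))
  obtain ⟨f, hf⟩ := key
  exact ⟨(↑hf.unit⁻¹ : R) • f, by simp⟩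

/-- Derivations of an Azumaya algebra over a local ring are inner. A functional `f` with `f 1 = 1`
corresponds under `A ⊗ Aᵐᵒᵖ ≃ End A` to a separability idempotent `∑ aᵢ ⊗ bᵢ`, and
`D = [∑ aᵢ D(bᵢ), -]`. -/
theorem IsAzumaya.exists_eq_commutator {R A : Type*} [CommRing R] [IsLocalRing R] [Ring A]
    [Algebra R A] [IsAzumaya R A] (D : A →ₗ[R] A) (hD : ∀ a b, D (a * b) = a * D b + D a * b) :
    ∃ x : A, ∀ a, D a = x * a - a * x := by
  have : Nontrivial A := (FaithfulSMul.algebraMap_injective R A).nontrivial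
  obtain ⟨f, hf⟩ := exists_dual_one_eq_one R A
  obtain ⟨e, he⟩ := (IsAzumaya.bij (R := R) (A := A)).2 (Algebra.linearMap R A ∘ₗ f)
  have hmul : ∀ t : A ⊗[R] Aᵐᵒᵖ, tensorOpEval LinearMap.id t = AlgHom.mulLeftRight R A t 1 := by
    intro t
    induction t with
    | zero => simp
    | tmul a b => simp [tensorOpEval_tmul]
    | add s t hs ht => simp [hs, ht]
  have hleft : ∀ (a : A) (t : A ⊗[R] Aᵐᵒᵖ),
      tensorOpEval D ((a ⊗ₜ 1) * t) = a * tensorOpEval D t := by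
    intro a t
    induction t with
    | zero => simp
    | tmul x y => simp [tensorOpEval_tmul, mul_assoc]
    | add s t hs ht => simp only [mul_add, map_add, hs, ht]
  have hright : ∀ (a : A) (t : A ⊗[R] Aᵐᵒᵖ),
      tensorOpEval D ((1 ⊗ₜ MulOpposite.op a) * t) =
        tensorOpEval D t * a + tensorOpEval LinearMap.id t * D a := by
    intro a t
    induction t with
    | zero => simp
    | tmul x y => simp [tensorOpEval_tmul, mul_assoc, hD, mul_add, add_comm]
    | add s t hs ht =>
      simp only [mul_add, map_add, hs, ht, add_mul]
      abel
  have hcomm : ∀ a : A, (a ⊗ₜ[R] (1 : Aᵐᵒᵖ)) * e = (1 ⊗ₜ MulOpposite.op a) * e := by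
    intro a
    apply (IsAzumaya.bij (R := R) (A := A)).1
    ext c
    simp [he, Algebra.commutes]
  refine ⟨-tensorOpEval D e, fun a => ?_⟩
  have h := hright a e
  rw [← hcomm, hleft, hmul, he] at h
  simp [hf] at h
  rw [mul_neg, neg_mul, h]
  abel

/-! ### Associated primes and localization -/

/-- Over a Noetherian ring, every nonzero `x` has a multiple whose annihilator is prime. -/
theorem exists_prime_mem_iff_smul_eq_zero {R M : Type*} [CommRing R] [IsNoetherianRing R]
    [AddCommGroup M] [Module R M] {x : M} (hx : x ≠ 0) :
    ∃ P : Ideal R, P.IsPrime ∧ ∃ z : R, ∀ r, r ∈ P ↔ r • z • x = 0 := by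
  let y : Submodule.span R {x} := ⟨x, Submodule.mem_span_singleton_self x⟩
  obtain ⟨P, hP, -⟩ := exists_le_isAssociatedPrime_of_isNoetherianRing R y
    (fun h => hx (congrArg Subtype.val h))
  obtain ⟨hP, ⟨w, hw⟩, rfl⟩ := isAssociatedPrime_iff.mp hP
  obtain ⟨z, rfl⟩ := Submodule.mem_span_singleton.mp hw
  refine ⟨_, hP, z, fun r => ?_⟩
  rw [Submodule.mem_colon_singleton, Submodule.mem_bot, ← Submodule.coe_eq_zero]
  rfl

theorem exists_annihilator_eq_zero {R M : Type*} [CommRing R] [IsDomain R] [AddCommGroup M]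
    [Module R M] [Module.Finite R M] (hAnn : Module.annihilator R M = ⊥) :
    ∃ m : M, ∀ r : R, r • m = 0 → r = 0 := by
  have h : (⟨⊥, Ideal.isPrime_bot⟩ : PrimeSpectrum R) ∈ Module.support R M := by
    rw [Module.mem_support_iff_of_finite, hAnn]
  obtain ⟨m, hm⟩ := Module.mem_support_iff_exists_annihilator.mp h
  exact ⟨m, fun r hr => hm ((Submodule.mem_annihilator_span_singleton _ _).mpr hr)⟩

/-- A finite module with zero annihilator over a domain has full support, also locally. -/
theorem supportDim_localizedModule {R M : Type*} [CommRing R] [IsDomain R] [AddCommGroup M]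
    [Module R M] [Module.Finite R M] (hAnn : Module.annihilator R M = ⊥)
    (p : PrimeSpectrum R) :
    Nontrivial (LocalizedModule p.asIdeal.primeCompl M) ∧
    Module.supportDim (Localization.AtPrime p.asIdeal)
      (LocalizedModule p.asIdeal.primeCompl M) = p.asIdeal.height := by
  obtain ⟨m, hm⟩ := exists_annihilator_eq_zero hAnn
  have key : ∀ r : Localization.AtPrime p.asIdeal,
      r • LocalizedModule.mkLinearMap p.asIdeal.primeCompl M m = 0 → r = 0 := by
    intro r hr
    obtain ⟨z, s, rfl⟩ := IsLocalization.exists_mk'_eq p.asIdeal.primeCompl r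
    rw [LocalizedModule.mkLinearMap_apply, ← Localization.mk_eq_mk', LocalizedModule.mk_smul_mk,
      ← LocalizedModule.zero_mk 1, LocalizedModule.mk_eq] at hr
    obtain ⟨t, ht⟩ := hr
    simp only [smul_zero, one_smul, Submonoid.smul_def, smul_smul] at ht
    have hz := (mul_eq_zero.mp (hm _ ht)).resolve_left
      (fun h => t.2 (by rw [h]; exact zero_mem _))
    rw [hz, IsLocalization.mk'_zero]
  have hnt : Nontrivial (LocalizedModule p.asIdeal.primeCompl M) := by
    refine ⟨LocalizedModule.mkLinearMap p.asIdeal.primeCompl M m, 0, fun h => ?_⟩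
    exact one_ne_zero (key 1 (by rw [one_smul, h]))
  have : Module.annihilator (Localization.AtPrime p.asIdeal)
      (LocalizedModule p.asIdeal.primeCompl M) = ⊥ := by
    rw [eq_bot_iff]
    intro r hr
    exact key r (Module.mem_annihilator.mp hr _)
  refine ⟨hnt, ?_⟩
  rw [Module.supportDim_eq_ringKrullDim_quotient_annihilator, this,
    (RingEquiv.quotientBot _).ringKrullDim,
    IsLocalization.AtPrime.ringKrullDim_eq_height p.asIdeal]

/-! ### Regular sequences on Cohen-Macaulay modules with full support -/

theorem CMModule.IsCM.exists_isRegular {R M : Type*} [CommRing R] [IsDomain R] [AddCommGroup M]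
    [Module R M] [Module.Finite R M] (hCM : CMModule.IsCM R M)
    (hAnn : Module.annihilator R M = ⊥) (p : PrimeSpectrum R) {n : ℕ}
    (hn : n < p.asIdeal.height) :
    ∃ rs : List (Localization.AtPrime p.asIdeal),
      RingTheory.Sequence.IsRegular (LocalizedModule p.asIdeal.primeCompl M) rs ∧
      (∀ r ∈ rs, r ∈ IsLocalRing.maximalIdeal (Localization.AtPrime p.asIdeal)) ∧
      n < rs.length := by
  obtain ⟨hnt, hdim⟩ := supportDim_localizedModule hAnn p
  have h := (hCM p).resolve_left (not_subsingleton_iff_nontrivial.mpr hnt)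
  rw [hdim, WithBot.coe_inj] at h
  rw [h, CMModule.localDepth, lt_iSup_iff] at hn
  obtain ⟨⟨rs, h1, h2⟩, h3⟩ := hn
  exact ⟨rs, h1, h2, by exact_mod_cast h3⟩

/-- A Cohen-Macaulay module with full support over a domain is torsion-free: at a nonzero
associated prime the depth would vanish, while the dimension of the support does not. -/
theorem CMModule.IsCM.eq_zero_of_smul_eq_zero {R M : Type*} [CommRing R] [IsDomain R]
    [IsNoetherianRing R] [AddCommGroup M]
    [Module R M] [Module.Finite R M] (hCM : CMModule.IsCM R M)
    (hAnn : Module.annihilator R M = ⊥) {r : R} {m : M} (hr : r ≠ 0) (h : r • m = 0) :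
    m = 0 := by
  by_contra hm
  obtain ⟨P, hP, z, hz⟩ := exists_prime_mem_iff_smul_eq_zero (R := R) hm
  have hrP : r ∈ P := by rw [hz, smul_comm, h, smul_zero]
  have hht : ((0 : ℕ) : ℕ∞) < P.height := by
    rw [Nat.cast_zero, pos_iff_ne_zero, ne_eq, Ideal.height_eq_zero_iff,
      IsDomain.minimalPrimes_eq_singleton_bot]
    rintro rfl
    exact hr hrP
  obtain ⟨rs, hreg, hmax, hlen⟩ := hCM.exists_isRegular hAnn ⟨P, hP⟩ hht
  match rs, hlen with
  | a :: rs, _ =>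
    have ha := ((RingTheory.Sequence.isRegular_cons_iff _ a rs).mp hreg).1
    have ham := hmax a (by simp)
    obtain ⟨c, s, rfl⟩ := IsLocalization.exists_mk'_eq P.primeCompl a
    have hc : c ∈ P := (IsLocalization.AtPrime.mk'_mem_maximal_iff _ P c s).mp ham
    have h0 : LocalizedModule.mk (z • m) (1 : P.primeCompl) = 0 := by
      apply isSMulRegular_iff_right_eq_zero_of_smul.mp ha
      rw [← Localization.mk_eq_mk', LocalizedModule.mk_smul_mk, (hz c).mp hc,
        LocalizedModule.zero_mk]
    rw [← LocalizedModule.zero_mk 1, LocalizedModule.mk_eq] at h0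
    obtain ⟨t, ht⟩ := h0
    simp only [smul_zero, one_smul, Submonoid.smul_def] at ht
    exact t.2 ((hz _).mpr ht)

/-- If `M` is Cohen-Macaulay with full support and `p` has height at least `2`, then two elements
`a, b` of `p` form a regular sequence on the localization of `M` at `p`. This is recorded without
localizing: `b x = a y` forces `x` to be divisible by `a` after multiplication by some `s ∉ p`. -/
theorem CMModule.IsCM.exists_regular_pair {R M : Type*} [CommRing R] [IsDomain R]
    [IsNoetherianRing R] [AddCommGroup M]
    [Module R M] [Module.Finite R M] (hCM : CMModule.IsCM R M)
    (hAnn : Module.annihilator R M = ⊥) (p : PrimeSpectrum R) (hp : 2 ≤ p.asIdeal.height) :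
    ∃ a ∈ p.asIdeal, ∃ b ∈ p.asIdeal, a ≠ 0 ∧
      ∀ x y : M, b • x = a • y → ∃ s ∉ p.asIdeal, ∃ w : M, s • x = a • w := by
  obtain ⟨rs, hreg, hmax, hlen⟩ := hCM.exists_isRegular hAnn p (n := 1)
    (lt_of_lt_of_le (by norm_num) hp)
  match rs, hlen with
  | a :: b :: rs, _ =>
    rw [RingTheory.Sequence.isRegular_cons_iff, RingTheory.Sequence.isRegular_cons_iff] at hreg
    obtain ⟨ha, hb, -⟩ := hreg
    have ham := hmax a (by simp)
    have hbm := hmax b (by simp)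
    obtain ⟨c, s, rfl⟩ := IsLocalization.exists_mk'_eq p.asIdeal.primeCompl a
    obtain ⟨d, t, rfl⟩ := IsLocalization.exists_mk'_eq p.asIdeal.primeCompl b
    refine ⟨c, (IsLocalization.AtPrime.mk'_mem_maximal_iff _ _ c s).mp ham,
      d, (IsLocalization.AtPrime.mk'_mem_maximal_iff _ _ d t).mp hbm, ?_, ?_⟩
    · rintro rfl
      obtain ⟨hnt, -⟩ := supportDim_localizedModule hAnn p
      obtain ⟨u, hu⟩ := exists_ne (0 : LocalizedModule p.asIdeal.primeCompl M)
      refine hu (isSMulRegular_iff_right_eq_zero_of_smul.mp ha u ?_)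
      rw [IsLocalization.mk'_zero, zero_smul]
    · intro x y hxy
      have hmem := mem_of_isSMulRegular_quotient_of_smul_mem hb
        (x := LocalizedModule.mk x 1) (by
          rw [Submodule.mem_smul_pointwise_iff_exists]
          refine ⟨LocalizedModule.mk (s • y) t, trivial, ?_⟩
          rw [← Localization.mk_eq_mk', LocalizedModule.mk_smul_mk,
            LocalizedModule.mk_smul_mk, hxy, LocalizedModule.mk_eq]
          refine ⟨1, ?_⟩
          simp only [Submonoid.smul_def, smul_smul]
          congr 1
          simp
          ring)
      rw [Submodule.mem_smul_pointwise_iff_exists] at hmem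
      obtain ⟨u, -, hu⟩ := hmem
      induction u using LocalizedModule.induction_on with
      | h w v =>
        rw [← Localization.mk_eq_mk', LocalizedModule.mk_smul_mk, LocalizedModule.mk_eq] at hu
        obtain ⟨t', ht'⟩ := hu
        refine ⟨t' * (s * v : p.asIdeal.primeCompl), ?_, (t' : R) • w, ?_⟩
        · exact (t' * (s * v)).2
        · simp only [Submonoid.smul_def, smul_smul, one_mul, OneMemClass.coe_one] at ht'
          rw [← ht', smul_smul, mul_comm]

/-! ### Derivations linear over the center -/

section CenterLinear

variable {Z A : Type*} [CommRing Z] [Ring A] [Algebra Z A]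

/-- The map `x ↦ [x, -]`, linear over a central subring. -/
def commutatorHom (Z A : Type*) [CommRing Z] [Ring A] [Algebra Z A] : A →ₗ[Z] A →ₗ[Z] A :=
  LinearMap.mul Z A - (LinearMap.mul Z A).flip

theorem commutatorHom_apply (x a : A) : commutatorHom Z A x a = x * a - a * x := rfl

/-- At a point of the Azumaya locus, a multiple of every derivation linear over the base by a
function not vanishing there is inner. -/
theorem exists_smul_eq_commutatorHom (htf : ∀ (r : Z) (a : A), r ≠ 0 → r • a = 0 → a = 0)
    {p : PrimeSpectrum Z} (hp : p ∈ azumayaLocus Z A) (D : A →ₗ[Z] A)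
    (hD : ∀ a b, D (a * b) = a * D b + D a * b) :
    ∃ s ∉ p.asIdeal, ∃ x : A, s • D = commutatorHom Z A x := by
  have hAz : IsAzumaya (Localization.AtPrime p.asIdeal)
    (Localization.AtPrime p.asIdeal ⊗[Z] A) := hp
  have hDp : ∀ a b : Localization.AtPrime p.asIdeal ⊗[Z] A,
      D.baseChange (Localization.AtPrime p.asIdeal) (a * b) =
        a * D.baseChange (Localization.AtPrime p.asIdeal) b +
        D.baseChange (Localization.AtPrime p.asIdeal) a * b := by
    intro a b
    induction a with
    | zero => simp
    | add a a' ha ha' =>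
      simp only [add_mul, map_add, ha, ha']
      abel
    | tmul u a =>
      induction b with
      | zero => simp
      | add b b' hb hb' =>
        simp only [mul_add, map_add, hb, hb']
        abel
      | tmul v b => simp [hD, TensorProduct.tmul_add]
  obtain ⟨x, hx⟩ := IsAzumaya.exists_eq_commutator _ hDp
  let ι := TensorProduct.mk Z (Localization.AtPrime p.asIdeal) A 1
  obtain ⟨⟨w, s⟩, hs⟩ := IsLocalizedModule.surj p.asIdeal.primeCompl ι x
  refine ⟨s, s.2, w, LinearMap.ext fun a => ?_⟩
  have h : ι (s • D a) = ι (w * a - a * w) := by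
    have h1 := hx (ι a)
    have h2 : ∀ u v : A, ι (u * v) = ι u * ι v := fun u v => by simp [ι]
    have h3 : D.baseChange (Localization.AtPrime p.asIdeal) (ι a) = ι (D a) := by simp [ι]
    rw [h3] at h1
    rw [map_sub, h2, h2, ← hs, Submonoid.smul_def, Submonoid.smul_def, map_smul, h1, smul_sub,
      smul_mul_assoc, mul_smul_comm]
  obtain ⟨c, hc⟩ := IsLocalizedModule.exists_of_eq (S := p.asIdeal.primeCompl) h
  rw [← sub_eq_zero, ← smul_sub] at hc
  exact sub_eq_zero.mp (htf c _ (fun h => c.2 (by rw [h]; exact zero_mem _)) hc)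

/-- If `A / Z` is Cohen-Macaulay with full support and `A` is Azumaya in codimension one, then the
`Z`-linear derivations of `A` are inner. -/
theorem exists_eq_commutatorHom [IsDomain Z] [IsNoetherianRing Z] [Module.Finite Z A]
    (hinj : Function.Injective (algebraMap Z A))
    (hcenter : ∀ x : A, (∀ a, x * a = a * x) → x ∈ LinearMap.range (Algebra.linearMap Z A))
    (hCM : CMModule.IsCM Z (A ⧸ LinearMap.range (Algebra.linearMap Z A)))
    (hAnn : Module.annihilator Z (A ⧸ LinearMap.range (Algebra.linearMap Z A)) = ⊥)
    (hcodim : 2 ≤ specCodim (azumayaLocus Z A)ᶜ) (D : A →ₗ[Z] A)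
    (hD : ∀ a b, D (a * b) = a * D b + D a * b) :
    ∃ x : A, D = commutatorHom Z A x := by
  set L := LinearMap.range (Algebra.linearMap Z A)
  have hker : ∀ x : A, commutatorHom Z A x = 0 ↔ x ∈ L := by
    intro x
    constructor
    · intro h
      exact hcenter x fun a => sub_eq_zero.mp (LinearMap.congr_fun h a)
    · rintro ⟨z, rfl⟩
      ext a
      simp [commutatorHom_apply, Algebra.commutes]
  have htf : ∀ (r : Z) (a : A), r ≠ 0 → r • a = 0 → a = 0 := by
    intro r a hr h
    have h1 : L.mkQ a = 0 := hCM.eq_zero_of_smul_eq_zero hAnn hr (by rw [← map_smul, h, map_zero])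
    obtain ⟨z, rfl⟩ := (Submodule.Quotient.mk_eq_zero L).mp h1
    rw [← map_smul, Algebra.linearMap_apply, map_eq_zero_iff _ hinj, smul_eq_mul] at h
    rw [(mul_eq_zero.mp h).resolve_left hr, map_zero]
  -- The obstruction ideal of a suitable multiple `z • D` is a prime `P`.
  by_contra hne
  have hx : (LinearMap.range (commutatorHom Z A)).mkQ D ≠ 0 := by
    intro h
    obtain ⟨x, hx⟩ := (Submodule.Quotient.mk_eq_zero _).mp h
    exact hne ⟨x, hx.symm⟩
  obtain ⟨P, hP, z, hz⟩ := exists_prime_mem_iff_smul_eq_zero (R := Z) hx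
  have hz' : ∀ r, r ∈ P ↔ ∃ x, commutatorHom Z A x = r • z • D := by
    intro r
    rw [hz, ← map_smul, ← map_smul, Submodule.mkQ_apply, Submodule.Quotient.mk_eq_zero]
    rfl
  by_cases hAz : (⟨P, hP⟩ : PrimeSpectrum Z) ∈ azumayaLocus Z A
  · obtain ⟨s, hs, x, h⟩ := exists_smul_eq_commutatorHom htf hAz (z • D) (fun a b => by
      simp [hD, smul_add])
    exact hs ((hz' s).mpr ⟨x, h.symm⟩)
  · have hht : 2 ≤ P.height := hcodim.trans (iInf₂_le (⟨P, hP⟩ : PrimeSpectrum Z) hAz)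
    obtain ⟨a, ha, b, hb, ha0, hab⟩ := hCM.exists_regular_pair hAnn ⟨P, hP⟩ hht
    obtain ⟨x, hx⟩ := (hz' a).mp ha
    obtain ⟨y, hy⟩ := (hz' b).mp hb
    obtain ⟨s, hs, w, hw⟩ := hab (L.mkQ x) (L.mkQ y) (by
      rw [← map_smul, ← map_smul, ← sub_eq_zero, ← map_sub, Submodule.mkQ_apply,
        Submodule.Quotient.mk_eq_zero, ← hker, map_sub, map_smul, map_smul, hx, hy, smul_comm,
        sub_self])
    obtain ⟨w, rfl⟩ := L.mkQ_surjective w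
    rw [← map_smul, ← map_smul, ← sub_eq_zero, ← map_sub, Submodule.mkQ_apply,
        Submodule.Quotient.mk_eq_zero, ← hker, map_sub, map_smul, map_smul, hx, smul_comm,
      sub_eq_zero] at hw
    refine hs ((hz' s).mpr ⟨w, ?_⟩)
    ext c
    refine (sub_eq_zero.mp (htf a _ ha0 ?_)).symm
    rw [smul_sub, sub_eq_zero]
    exact LinearMap.congr_fun hw c

end CenterLinear

end

theorem lemma2 (k : Type*) [Field k] [IsAlgClosed k] (p : ℕ) [Fact p.Prime] [CharP k p]
    (hp : 2 < p)
    (A : Type*) [Ring A] [Algebra k A]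
    [IsNoetherianRing (Subalgebra.center k A)]
    [Module.Finite (Subalgebra.center k A) A]
    [IsDomain (Subalgebra.center k A)]
    [IsIntegrallyClosed (Subalgebra.center k A)]
    (hCM : CMModule.IsCM (Subalgebra.center k A)
      (A ⧸ LinearMap.range (Algebra.linearMap (Subalgebra.center k A) A)))
    (hAnn : Module.annihilator (Subalgebra.center k A)
      (A ⧸ LinearMap.range (Algebra.linearMap (Subalgebra.center k A) A)) = ⊥)
    (hcodim : 2 ≤ specCodim (azumayaLocus (Subalgebra.center k A) A)ᶜ) :
    (∀ D : AssocAlg.Der k A, (∀ z ∈ Subalgebra.center k A, D z = 0) →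
      ∃ x : A, D = AssocAlg.ad k A x) ∧
    Function.Injective (AssocAlg.resHH1 k A) := by
  have key : ∀ D : AssocAlg.Der k A, (∀ z ∈ Subalgebra.center k A, D z = 0) →
      ∃ x : A, D = AssocAlg.ad k A x := by
    intro D hD
    let D' : A →ₗ[Subalgebra.center k A] A :=
      { toFun := D
        map_add' := D.map_add'
        map_smul' := fun z a => by
          change D ((z : A) * a) = (z : A) * D a
          rw [D.leibniz, hD z z.2, zero_mul, add_zero] }
    obtain ⟨x, hx⟩ := exists_eq_commutatorHom (Z := Subalgebra.center k A)
      Subtype.val_injective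
      (fun x h => ⟨⟨x, Subalgebra.mem_center_iff.mpr fun a => (h a).symm⟩, rfl⟩)
      hCM hAnn hcodim D' D.leibniz
    exact ⟨x, DFunLike.ext _ _ fun a => LinearMap.congr_fun hx a⟩
  refine ⟨key, (injective_iff_map_eq_zero _).mpr fun c hc => ?_⟩
  obtain ⟨D, rfl⟩ := Submodule.Quotient.mk_surjective _ c
  rw [AssocAlg.resHH1_mk] at hc
  obtain ⟨x, rfl⟩ := key D fun z hz =>
    congrArg Subtype.val (DFunLike.congr_fun hc (⟨z, hz⟩ : Subalgebra.center k A))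
  exact (Submodule.Quotient.mk_eq_zero _).mpr ⟨x, rfl⟩
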